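/- Let $m\ge 2$ and $n\ge 1$, and let $\mathcal{A}=(a_{i_1i_2\cdots i_m})$ be a tensor of order $m$ and dimension $n$ with nonnegative real entries ($1\le i_1,\dots,i_m\le n$). For a tensor $\mathcal{C}$ of order $p$ and dimension $n$ put $r_i(\mathcal{C})=\sum_{i_2,\dots,i_p=1}^n|c_{ii_2\cdots i_p}|$. For tensors $\mathcal{B}$, $\mathcal{C}$ of dimension $n$ and orders $p\ge 2$, $q\ge 1$, the general product $\mathcal{B}\mathcal{C}$ is the tensor of order $(p-1)(q-1)+1$ and dimension $n$ with entries \[(\mathcal{B}\mathcal{C})_{i\alpha_1\cdots\alpha_{p-1}}=\sum_{i_2,\dots,i_p=1}^n b_{ii_2\cdots i_p}\,c_{i_2\alpha_1}\cdots c_{i_p\alpha_{p-1}},\qquad \alpha_1,\dots,\alpha_{p-1}\in\{1,\dots,n\}^{q-1}.\] Let $\mathcal{A}^0$ be the $n\times n$ identity matrix (a tensor of order $2$), $\mathcal{A}^1=\mathcal{A}$, and $\mathcal{A}^{k+1}=\mathcal{A}\mathcal{A}^k$ for $k\ge 1$. A number $\lambda\in\mathbb{C}$ is an eigenvalue of $\mathcal{A}$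 if there is a nonzero $x\in\mathbb{C}^n$ with $\sum_{i_2,\dots,i_m=1}^n a_{ii_2\cdots i_m}x_{i_2}\cdots x_{i_m}=\lambda x_i^{m-1}$ for all $i$, and $\rho(\mathcal{A})$ denotes the maximum of $|\lambda|$ over all eigenvalues $\lambda$ of $\mathcal{A}$. Suppose that $r_i(\mathcal{A})\ne 0$ for all $i$. Then this maximum exists, and for every integer $k\ge 0$ we have $r_i(\mathcal{A}^k)\neq 0$ for all $i$ and \[\min_{1\le i\le n}\frac{r_i(\mathcal{A}^{k+1})}{\bigl(r_i(\mathcal{A}^k)\bigr)^{m-1}}\le\rho(\mathcal{A})\le\max_{1\le i\le n}\frac{r_i(\mathcal{A}^{k+1})}{\bigl(r_i(\mathcal{A}^k)\bigr)^{m-1}}.\] -/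

import Mathlib

/-- Tensors of order `m` and dimension `n` with entries in `R`, for `m ≥ 1`. The first index
`i₁` is kept apart from the tuple `(i₂, …, i_m)` of the other `m - 1` indices: the entry
`a_{i₁ i₂ ⋯ i_m}` is `A i₁ j` with `j = (i₂, …, i_m)`. -/
abbrev Tensor (R : Type*) (m n : ℕ) : Type _ :=
  Fin n → (Fin (m - 1) → Fin n) → R

namespace Tensor

/-- `r_i(A)`, the sum of `|a_{i i₂ ⋯ i_m}|` over all `i₂, …, i_m`. -/
noncomputable def rowSum {R : Type*} [Norm R] {m n : ℕ} (A : Tensor R m n) (i : Fin n) : ℝ :=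
  ∑ j : Fin (m - 1) → Fin n, ‖A i j‖

/-- The vector `A x^{m-1}`. -/
def apply {R : Type*} [CommSemiring R] {m n : ℕ} (A : Tensor R m n) (x : Fin n → R) :
    Fin n → R :=
  fun i => ∑ j : Fin (m - 1) → Fin n, A i j * ∏ l : Fin (m - 1), x (j l)

/-- The set of eigenvalues of a complex tensor: all `μ` such that
`A x^{m-1} = μ x^{[m-1]}` for some nonzero complex vector `x`. -/
def spectrum {m n : ℕ} (A : Tensor ℂ m n) : Set ℂ :=
  {μ | ∃ x : Fin n → ℂ, x ≠ 0 ∧ ∀ i, A.apply x i = μ * x i ^ (m - 1)}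

/-- The moduli of the eigenvalues. -/
def spectralModuli {m n : ℕ} (A : Tensor ℂ m n) : Set ℝ :=
  (fun μ : ℂ => ‖μ‖) '' A.spectrum

/-- The spectral radius, the largest modulus of an eigenvalue. -/
noncomputable def spectralRadius {m n : ℕ} (A : Tensor ℂ m n) : ℝ :=
  sSup A.spectralModuli

/-- A real tensor, regarded as a complex one. -/
noncomputable def toComplex {m n : ℕ} (A : Tensor ℝ m n) : Tensor ℂ m n :=
  fun i j => (A i j : ℂ)

/-- The general product `A B` of a tensor of order `m` and a tensor of order `k`, a tensor of order
`(m - 1)(k - 1) + 1`. The last `(m - 1)(k - 1)` indices are the concatenation of `m - 1` blocks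
`α_1, …, α_{m-1}` of length `k - 1`; position `t` of block `l` is `finProdFinEquiv (l, t)`. -/
def mul {R : Type*} [CommSemiring R] {m k n : ℕ} (A : Tensor R m n) (B : Tensor R k n) :
    Tensor R ((m - 1) * (k - 1) + 1) n :=
  fun i (α : Fin ((m - 1) * (k - 1)) → Fin n) =>
    ∑ j : Fin (m - 1) → Fin n,
      A i j * ∏ l : Fin (m - 1), B (j l) (fun t : Fin (k - 1) => α (finProdFinEquiv (l, t)))

/-- The identity matrix, as a tensor of order `2`. It is the unit of the general product. -/
def unit (R : Type*) [CommSemiring R] (n : ℕ) : Tensor R 2 n :=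
  fun i j => if i = j 0 then 1 else 0

/-- The order of the `k`-th power of a tensor of order `m`. -/
def powOrder (m : ℕ) : ℕ → ℕ
  | 0 => 2
  | 1 => m
  | k + 2 => (m - 1) * (powOrder m (k + 1) - 1) + 1

/-- Powers in the general product: `A⁰` is the identity matrix, `A¹ = A`, and
`A^{k+1} = A A^k` for `k ≥ 1`. -/
def pow {R : Type*} [CommSemiring R] {m n : ℕ} (A : Tensor R m n) :
    (k : ℕ) → Tensor R (powOrder m k) n
  | 0 => unit R n
  | 1 => A
  | k + 2 => A.mul (pow A (k + 1))

end Tensor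

/-! For nonnegative tensors the row sums of `A^(k+1)` are `A x^{m-1}` with `x` the row sums of `A^k`
(`rowSum_pow_succ`), and this `x` is positive. The bounds are thus Collatz–Wielandt bounds for
`ρ(A)` at a positive vector. They follow once `ρ(A)` is known to be the largest subeigenvalue `t`:
the minimal quotient is itself a subeigenvalue, and `IsSubeigenvalue.le_of_apply_le` bounds `t` by
the maximal one. Compactness gives `t`; the triangle inequality bounds every eigenvalue modulus by
`t`; and `t` is an eigenvalue, by a strict-improvement argument for positive tensors and a limit in
general. -/

open Filter Topology

namespace Tensor

/-! ### Row sums of products and powers -/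

section RowSum

variable {m k n : ℕ}

lemma rowSum_eq_apply_one {A : Tensor ℝ m n} (hA : ∀ i j, 0 ≤ A i j) (i : Fin n) :
    A.rowSum i = A.apply (fun _ => 1) i := by
  simp [rowSum, apply, abs_of_nonneg (hA _ _)]

lemma mul_nonneg {A : Tensor ℝ m n} {B : Tensor ℝ k n} (hA : ∀ i j, 0 ≤ A i j)
    (hB : ∀ i j, 0 ≤ B i j) (i : Fin n) (α : Fin ((m - 1) * (k - 1)) → Fin n) :
    0 ≤ A.mul B i α :=
  Finset.sum_nonneg fun _ _ =>
    _root_.mul_nonneg (hA _ _) (Finset.prod_nonneg fun _ _ => hB _ _)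

lemma pow_nonneg {A : Tensor ℝ m n} (hA : ∀ i j, 0 ≤ A i j) :
    ∀ (k : ℕ) (i : Fin n) (j : Fin (powOrder m k - 1) → Fin n), 0 ≤ A.pow k i j
  | 0, i, j => by
    change 0 ≤ unit ℝ n i j
    unfold unit
    split_ifs <;> norm_num
  | 1, i, j => hA i j
  | k + 2, i, j => mul_nonneg hA (pow_nonneg hA (k + 1)) i j

/-- Splitting a tuple indexed by `Fin (p * q)` into `p` blocks of length `q`. -/
def blockEquiv (p q n : ℕ) : (Fin (p * q) → Fin n) ≃ (Fin p → Fin q → Fin n) :=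
  (Equiv.arrowCongr finProdFinEquiv.symm (Equiv.refl _)).trans (Equiv.curry _ _ _)

lemma sum_prod_blocks {p q n : ℕ} (f : Fin p → (Fin q → Fin n) → ℝ) :
    ∑ α : Fin (p * q) → Fin n, ∏ l, f l (fun t => α (finProdFinEquiv (l, t))) =
      ∏ l, ∑ β, f l β := by
  rw [Finset.prod_univ_sum, Fintype.piFinset_univ]
  exact (blockEquiv p q n).sum_comp fun β => ∏ l, f l (β l)

/-- The blocks of `α` vary independently, so the sum over `α` of the product of entries of `B`
factors into row sums of `B`. -/
lemma rowSum_mul {A : Tensor ℝ m n} {B : Tensor ℝ k n} (hA : ∀ i j, 0 ≤ A i j)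
    (hB : ∀ i j, 0 ≤ B i j) (i : Fin n) : (A.mul B).rowSum i = A.apply B.rowSum i := by
  have hBr : ∀ i, B.rowSum i = ∑ j, B i j := fun i => by
    simp [rowSum, abs_of_nonneg (hB _ _)]
  calc (A.mul B).rowSum i
      = ∑ α : Fin ((m - 1) * (k - 1)) → Fin n, A.mul B i α :=
        Finset.sum_congr rfl fun α _ => by
          rw [Real.norm_eq_abs]; exact abs_of_nonneg (mul_nonneg hA hB i α)
    _ = A.apply B.rowSum i := by
        simp only [mul, apply, hBr]
        rw [Finset.sum_comm]
        refine Finset.sum_congr rfl fun j _ => ?_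
        rw [← Finset.mul_sum, sum_prod_blocks fun l => B (j l)]

lemma rowSum_pow_zero (A : Tensor ℝ m n) (i : Fin n) : (A.pow 0).rowSum i = 1 := by
  change ∑ j : Fin 1 → Fin n, ‖unit ℝ n i j‖ = 1
  rw [← (Equiv.funUnique (Fin 1) (Fin n)).symm.sum_comp]
  simp [unit, apply_ite]

lemma rowSum_pow_succ {A : Tensor ℝ m n} (hA : ∀ i j, 0 ≤ A i j) (k : ℕ) (i : Fin n) :
    (A.pow (k + 1)).rowSum i = A.apply (A.pow k).rowSum i := by
  cases k with
  | zero =>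
    -- `A¹` is `A` itself, not `A.mul (unit ℝ n)`, so `rowSum_mul` does not cover this case.
    rw [show (A.pow 0).rowSum = fun _ => 1 from funext A.rowSum_pow_zero]
    exact rowSum_eq_apply_one hA i
  | succ k => exact rowSum_mul hA (pow_nonneg hA (k + 1)) i

end RowSum

/-! ### Monotonicity and homogeneity of `x ↦ A x^{m-1}` -/

section Apply

variable {m n : ℕ} {A : Tensor ℝ m n} {x y : Fin n → ℝ}

lemma apply_nonneg (hA : ∀ i j, 0 ≤ A i j) (hx : ∀ i, 0 ≤ x i) (i : Fin n) :
    0 ≤ A.apply x i :=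
  Finset.sum_nonneg fun _ _ =>
    _root_.mul_nonneg (hA _ _) (Finset.prod_nonneg fun _ _ => hx _)

lemma apply_mono (hA : ∀ i j, 0 ≤ A i j) (hx : ∀ i, 0 ≤ x i) (hxy : ∀ i, x i ≤ y i)
    (i : Fin n) : A.apply x i ≤ A.apply y i :=
  Finset.sum_le_sum fun _ _ =>
    mul_le_mul_of_nonneg_left (Finset.prod_le_prod (fun _ _ => hx _) fun _ _ => hxy _) (hA _ _)

lemma apply_smul (A : Tensor ℝ m n) (c : ℝ) (x : Fin n → ℝ) (i : Fin n) :
    A.apply (fun l => c * x l) i = c ^ (m - 1) * A.apply x i := by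
  simp only [apply, Finset.prod_mul_distrib, Finset.mul_sum, Finset.prod_const, Finset.card_univ,
    Fintype.card_fin]
  exact Finset.sum_congr rfl fun _ _ => by ring

lemma apply_lt_apply (hm : m - 1 ≠ 0) (hA : ∀ i j, 0 < A i j) (hx : ∀ i, 0 ≤ x i)
    (hxy : ∀ i, x i ≤ y i) {l : Fin n} (hl : x l < y l) (i : Fin n) :
    A.apply x i < A.apply y i := by
  refine Finset.sum_lt_sum (fun j _ => mul_le_mul_of_nonneg_left
    (Finset.prod_le_prod (fun _ _ => hx _) fun _ _ => hxy _) (hA _ _).le)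
    ⟨fun _ => l, Finset.mem_univ _, ?_⟩
  simp only [Finset.prod_const, Finset.card_univ, Fintype.card_fin]
  exact mul_lt_mul_of_pos_left (pow_lt_pow_left₀ hl (hx l) hm) (hA _ _)

lemma apply_pos (hA : ∀ i j, 0 ≤ A i j) (hr : ∀ i, A.rowSum i ≠ 0) (hx : ∀ i, 0 < x i)
    (i : Fin n) : 0 < A.apply x i := by
  obtain ⟨j, -, hj⟩ : ∃ j ∈ Finset.univ, ‖A i j‖ ≠ 0 :=
    Finset.exists_ne_zero_of_sum_ne_zero (hr i)
  refine Finset.sum_pos' (fun _ _ => _root_.mul_nonneg (hA _ _)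
    (Finset.prod_nonneg fun _ _ => (hx _).le)) ⟨j, Finset.mem_univ _, ?_⟩
  exact mul_pos ((hA i j).lt_of_ne' (norm_ne_zero_iff.1 hj)) (Finset.prod_pos fun _ _ => hx _)

lemma rowSum_pow_pos (hA : ∀ i j, 0 ≤ A i j) (hr : ∀ i, A.rowSum i ≠ 0) (k : ℕ) :
    ∀ i, 0 < (A.pow k).rowSum i := by
  induction k with
  | zero => intro i; rw [rowSum_pow_zero]; exact one_pos
  | succ k ih => intro i; rw [rowSum_pow_succ hA]; exact apply_pos hA hr ih i

lemma continuous_apply_vec (A : Tensor ℝ m n) (i : Fin n) :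
    Continuous fun x : Fin n → ℝ => A.apply x i := by
  unfold apply; fun_prop

end Apply

/-! ### Subeigenvalues and the weak Perron–Frobenius theorem -/

section PerronFrobenius

variable {m n : ℕ}

/-- `t` is a subeigenvalue of `A` if `t x^{[m-1]} ≤ A x^{m-1}` for some `x` in the simplex. -/
def IsSubeigenvalue (A : Tensor ℝ m n) (t : ℝ) : Prop :=
  ∃ x ∈ stdSimplex ℝ (Fin n), ∀ i, t * x i ^ (m - 1) ≤ A.apply x i

lemma exists_pos_of_mem_stdSimplex {x : Fin n → ℝ} (hx : x ∈ stdSimplex ℝ (Fin n)) :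
    ∃ i, 0 < x i := by
  by_contra! h
  have := Finset.sum_nonpos fun i (_ : i ∈ Finset.univ) => h i
  rw [hx.2] at this
  linarith

/-- Both sides are homogeneous of degree `m - 1`, so `x` may be rescaled into the simplex. -/
lemma isSubeigenvalue_of_le {A : Tensor ℝ m n} {t : ℝ} {x : Fin n → ℝ} (hx : ∀ i, 0 ≤ x i)
    (hx0 : x ≠ 0) (h : ∀ i, t * x i ^ (m - 1) ≤ A.apply x i) : A.IsSubeigenvalue t := by
  obtain ⟨l, hl⟩ := Function.ne_iff.1 hx0
  have hs : 0 < ∑ i, x i :=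
    Finset.sum_pos' (fun i _ => hx i) ⟨l, Finset.mem_univ _, (hx l).lt_of_ne' hl⟩
  refine ⟨fun i => (∑ i, x i)⁻¹ * x i, ⟨fun i => ?_, ?_⟩, fun i => ?_⟩
  · have := hx i
    positivity
  · rw [← Finset.mul_sum, inv_mul_cancel₀ hs.ne']
  · rw [apply_smul, mul_pow, mul_left_comm]
    exact mul_le_mul_of_nonneg_left (h i) (by positivity)

/-- A subeigenvalue is at most the maximal ratio `(A x^{m-1})_i / x_i^{m-1}`, for every
positive `x`. -/
lemma IsSubeigenvalue.le_of_apply_le {A : Tensor ℝ m n} (hA : ∀ i j, 0 ≤ A i j) {t M : ℝ}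
    (ht : A.IsSubeigenvalue t) {x : Fin n → ℝ} (hx : ∀ i, 0 < x i)
    (h : ∀ i, A.apply x i ≤ M * x i ^ (m - 1)) : t ≤ M := by
  obtain ⟨y, hy, hty⟩ := ht
  obtain ⟨l, hl⟩ := exists_pos_of_mem_stdSimplex hy
  -- With `i` maximizing `y i / x i`, the vector `(y i / x i) x` dominates `y` and agrees with it at
  -- `i`; the inequalities are compared there.
  obtain ⟨i, -, hi⟩ := Finset.exists_max_image Finset.univ (fun i => y i / x i)
    ⟨l, Finset.mem_univ _⟩
  have hi' : ∀ j, y j ≤ y i / x i * x j := fun j =>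
    (div_le_iff₀ (hx j)).1 (hi j (Finset.mem_univ _))
  have hyi : 0 < y i := by
    have := (div_pos hl (hx l)).trans_le (hi l (Finset.mem_univ _))
    exact (div_pos_iff_of_pos_right (hx i)).1 this
  refine le_of_mul_le_mul_right ?_ (pow_pos hyi (m - 1))
  calc t * y i ^ (m - 1) ≤ A.apply y i := hty i
    _ ≤ A.apply (fun j => y i / x i * x j) i := apply_mono hA hy.1 hi' i
    _ = (y i / x i) ^ (m - 1) * A.apply x i := apply_smul _ _ _ _
    _ ≤ (y i / x i) ^ (m - 1) * (M * x i ^ (m - 1)) :=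
        mul_le_mul_of_nonneg_left (h i) (pow_pos (div_pos hyi (hx i)) _).le
    _ = M * y i ^ (m - 1) := by
        rw [mul_left_comm, ← mul_pow, div_mul_cancel₀ _ (hx i).ne']

lemma IsSubeigenvalue.le_sum_rowSum {A : Tensor ℝ m n} (hA : ∀ i j, 0 ≤ A i j) {t : ℝ}
    (ht : A.IsSubeigenvalue t) : t ≤ ∑ i, A.rowSum i := by
  refine ht.le_of_apply_le hA (x := fun _ => 1) (fun _ => one_pos) fun i => ?_
  rw [← rowSum_eq_apply_one hA, one_pow, mul_one]
  exact Finset.single_le_sum (f := A.rowSum)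
    (fun i _ => Finset.sum_nonneg fun _ _ => norm_nonneg _) (Finset.mem_univ i)

lemma IsSubeigenvalue.mono {A B : Tensor ℝ m n} (hAB : ∀ i j, A i j ≤ B i j) {t : ℝ}
    (ht : A.IsSubeigenvalue t) : B.IsSubeigenvalue t := by
  obtain ⟨x, hx, h⟩ := ht
  exact ⟨x, hx, fun i => (h i).trans (Finset.sum_le_sum fun j _ =>
    mul_le_mul_of_nonneg_right (hAB i j) (Finset.prod_nonneg fun _ _ => hx.1 _))⟩

/-- The vector of moduli of an eigenvector is a witness, by the triangle inequality. -/
lemma isSubeigenvalue_norm {A : Tensor ℝ m n} (hA : ∀ i j, 0 ≤ A i j) {μ : ℂ}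
    (hμ : μ ∈ A.toComplex.spectrum) : A.IsSubeigenvalue ‖μ‖ := by
  obtain ⟨x, hx, h⟩ := hμ
  obtain ⟨l, hl⟩ := Function.ne_iff.1 hx
  refine isSubeigenvalue_of_le (x := fun i => ‖x i‖) (fun _ => norm_nonneg _)
    (Function.ne_iff.2 ⟨l, norm_ne_zero_iff.2 hl⟩) fun i => ?_
  rw [← norm_pow, ← norm_mul, ← h i]
  refine (norm_sum_le _ _).trans_eq (Finset.sum_congr rfl fun j _ => ?_)
  rw [norm_mul, norm_prod, toComplex, Complex.norm_real, Real.norm_of_nonneg (hA i j)]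

variable [NeZero n]

lemma isSubeigenvalue_zero {A : Tensor ℝ m n} (hA : ∀ i j, 0 ≤ A i j) : A.IsSubeigenvalue 0 :=
  isSubeigenvalue_of_le (x := fun _ => 1) (fun _ => zero_le_one)
    (Function.ne_iff.2 ⟨0, one_ne_zero⟩) fun i => by
      rw [zero_mul]; exact apply_nonneg hA (fun _ => zero_le_one) i

lemma exists_isGreatest_subeigenvalue {A : Tensor ℝ m n} (hA : ∀ i j, 0 ≤ A i j) :
    ∃ t, IsGreatest {t | A.IsSubeigenvalue t} t := by
  -- Maximize `t` over pairs `(t, x)` in a compact set. Requiring `0 ≤ t` loses nothing, since `0`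
  -- is a subeigenvalue.
  set K : Set (ℝ × (Fin n → ℝ)) := Set.Icc 0 (∑ i, A.rowSum i) ×ˢ stdSimplex ℝ (Fin n)
  set S : Set (ℝ × (Fin n → ℝ)) := K ∩ {p | ∀ i, p.1 * p.2 i ^ (m - 1) ≤ A.apply p.2 i}
  have hS : IsCompact S := by
    refine (isCompact_Icc.prod (isCompact_stdSimplex ℝ _)).inter_right ?_
    rw [Set.ofPred_forall]
    refine isClosed_iInter fun i => isClosed_le (by fun_prop) ?_
    exact (A.continuous_apply_vec i).comp continuous_snd
  have hmem : ∀ t, 0 ≤ t → A.IsSubeigenvalue t → ∃ x, (t, x) ∈ S := by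
    rintro t h0 ht
    have := ht.le_sum_rowSum hA
    obtain ⟨x, hx, h⟩ := ht
    exact ⟨x, ⟨⟨h0, this⟩, hx⟩, h⟩
  obtain ⟨x₀, hx₀⟩ := hmem 0 le_rfl (isSubeigenvalue_zero hA)
  obtain ⟨⟨t, x⟩, htx, hmax⟩ := hS.exists_isMaxOn ⟨_, hx₀⟩ continuous_fst.continuousOn
  refine ⟨t, ⟨x, htx.1.2, htx.2⟩, fun s hs => ?_⟩
  rcases le_total 0 s with h0 | h0
  · obtain ⟨y, hy⟩ := hmem s h0 hs
    exact hmax hy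
  · exact h0.trans htx.1.1.1

/-- The largest subeigenvalue of a positive tensor is an eigenvalue. -/
lemma exists_eigenvector_of_pos (hm : m - 1 ≠ 0) {A : Tensor ℝ m n} (hA : ∀ i j, 0 < A i j)
    {t : ℝ} (ht : IsGreatest {t | A.IsSubeigenvalue t} t) :
    ∃ x ∈ stdSimplex ℝ (Fin n), ∀ i, A.apply x i = t * x i ^ (m - 1) := by
  have hA' := fun i j => (hA i j).le
  have ht0 : 0 ≤ t := ht.2 (isSubeigenvalue_zero hA')
  obtain ⟨x, hx, hle⟩ := ht.1
  refine ⟨x, hx, ?_⟩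
  by_contra! hne
  obtain ⟨l, hl⟩ := hne
  have hlt : t * x l ^ (m - 1) < A.apply x l := (hle l).lt_of_ne' hl
  have hpos : ∀ i, 0 < A.apply x i := by
    obtain ⟨r, hr⟩ := exists_pos_of_mem_stdSimplex hx
    intro i
    have h := apply_lt_apply (x := 0) hm hA (fun _ => le_rfl) hx.1 hr i
    exact (apply_nonneg hA' (fun _ => le_rfl) i).trans_lt h
  set p : ℝ := ((m - 1 : ℕ) : ℝ)⁻¹
  set c : ℝ := t ^ p
  have hc0 : 0 ≤ c := Real.rpow_nonneg ht0 _
  have hc : c ^ (m - 1) = t := Real.rpow_inv_natCast_pow ht0 hm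
  -- As `y^{[m-1]} = A x^{m-1}`, `y` dominates `c x`, strictly at `l`. Positivity of `A` spreads the
  -- strictness to every coordinate: `A y^{m-1} > A (c x)^{m-1} = t y^{[m-1]}`. So `y` admits a
  -- subeigenvalue above `t`.
  set y : Fin n → ℝ := fun i => A.apply x i ^ p
  have hy0 : ∀ i, 0 < y i := fun i => Real.rpow_pos_of_pos (hpos i) _
  have hy : ∀ i, y i ^ (m - 1) = A.apply x i := fun i =>
    Real.rpow_inv_natCast_pow (hpos i).le hm
  have hcx : ∀ i, 0 ≤ c * x i := fun i => _root_.mul_nonneg hc0 (hx.1 i)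
  have hxy : ∀ i, c * x i ≤ y i := fun i =>
    le_of_pow_le_pow_left₀ hm (hy0 i).le (by rw [mul_pow, hc, hy]; exact hle i)
  have hxyl : c * x l < y l :=
    lt_of_pow_lt_pow_left₀ (m - 1) (hy0 l).le (by rw [mul_pow, hc, hy]; exact hlt)
  have hy1 : ∀ i, t * y i ^ (m - 1) < A.apply y i := fun i => by
    have := apply_lt_apply hm hA hcx hxy hxyl i
    rwa [apply_smul, hc, ← hy] at this
  set s := Finset.univ.inf' Finset.univ_nonempty fun i => A.apply y i / y i ^ (m - 1)
  have hts : t < s := (Finset.lt_inf'_iff _).2 fun i _ =>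
    (lt_div_iff₀ (pow_pos (hy0 i) _)).2 (hy1 i)
  refine hts.not_ge (ht.2 (isSubeigenvalue_of_le (fun i => (hy0 i).le)
    (Function.ne_iff.2 ⟨l, (hy0 l).ne'⟩) fun i => ?_))
  exact (le_div_iff₀ (pow_pos (hy0 i) _)).1 (Finset.inf'_le _ (Finset.mem_univ i))

/-- The weak Perron–Frobenius theorem: the largest subeigenvalue of a nonnegative tensor is an
eigenvalue with a nonnegative eigenvector. -/
lemma exists_eigenvector_of_nonneg (hm : m - 1 ≠ 0) {A : Tensor ℝ m n} (hA : ∀ i j, 0 ≤ A i j)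
    {t : ℝ} (ht : IsGreatest {t | A.IsSubeigenvalue t} t) :
    ∃ x ∈ stdSimplex ℝ (Fin n), ∀ i, A.apply x i = t * x i ^ (m - 1) := by
  set ε : ℕ → ℝ := fun k => 1 / ((k : ℝ) + 1)
  have hε0 : ∀ k, 0 < ε k := fun k => Nat.one_div_pos_of_nat
  have hε1 : ∀ k, ε k ≤ 1 := fun k => by
    refine (div_le_one (by positivity)).2 ?_
    have : (0 : ℝ) ≤ k := Nat.cast_nonneg k
    linarith
  set B : ℝ → Tensor ℝ m n := fun e i j => A i j + e
  have hB : ∀ k i j, 0 < B (ε k) i j := fun k i j => add_pos_of_nonneg_of_pos (hA i j) (hε0 k)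
  have hB1 : ∀ i j, 0 ≤ B 1 i j := fun i j => add_nonneg (hA i j) zero_le_one
  choose s hs using fun k => exists_isGreatest_subeigenvalue fun i j => (hB k i j).le
  choose x hx hxe using fun k => exists_eigenvector_of_pos hm (hB k) (hs k)
  -- Adding `ε k` to the entries only raises the largest subeigenvalue, and `B 1` bounds all of
  -- them, so a subsequence of `(s k, x k)` converges with limit value at least `t`.
  have hts : ∀ k, t ≤ s k := fun k =>
    (hs k).2 (ht.1.mono fun i j => le_add_of_nonneg_right (hε0 k).le)
  have hsb : ∀ k, s k ≤ ∑ i, (B 1).rowSum i := fun k =>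
    ((hs k).1.mono fun i j => add_le_add_right (hε1 k) (A i j)).le_sum_rowSum hB1
  obtain ⟨⟨r, z⟩, hrz, φ, hφ, hlim⟩ :=
    ((isCompact_Icc (a := t)).prod (isCompact_stdSimplex ℝ (Fin n))).tendsto_subseq
      (x := fun k => (s k, x k)) fun k => ⟨⟨hts k, hsb k⟩, hx k⟩
  have hr : Tendsto (fun k => s (φ k)) atTop (𝓝 r) :=
    (continuous_fst.tendsto _).comp hlim
  have hz : Tendsto (fun k => x (φ k)) atTop (𝓝 z) :=
    (continuous_snd.tendsto _).comp hlim
  have hε : Tendsto (fun k => ε (φ k)) atTop (𝓝 0) :=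
    tendsto_one_div_add_atTop_nhds_zero_nat.comp hφ.tendsto_atTop
  have heq : ∀ i, A.apply z i = r * z i ^ (m - 1) := fun i => by
    have hcont : Continuous fun p : ℝ × (Fin n → ℝ) => (B p.1).apply p.2 i := by
      unfold apply; fun_prop
    have h1 := (hcont.tendsto (0, z)).comp (hε.prodMk_nhds hz)
    have h2 : Tendsto (fun k => s (φ k) * x (φ k) i ^ (m - 1)) atTop
        (𝓝 (r * z i ^ (m - 1))) := hr.mul (((tendsto_pi_nhds.1 hz) i).pow _)
    have h3 : (B 0).apply z i = r * z i ^ (m - 1) :=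
      tendsto_nhds_unique h1 (h2.congr fun k => (hxe (φ k) i).symm)
    rwa [show B 0 = A from funext fun i => funext fun j => add_zero _] at h3
  -- The limit `r` is a subeigenvalue of `A`, hence at most `t`.
  have hrt : r = t := le_antisymm (ht.2 ⟨z, hrz.2, fun i => (heq i).ge⟩) hrz.1.1
  exact ⟨z, hrz.2, fun i => hrt ▸ heq i⟩

/-- The largest subeigenvalue of a nonnegative tensor is the largest modulus of an eigenvalue. -/
lemma isGreatest_spectralModuli (hm : m - 1 ≠ 0) {A : Tensor ℝ m n} (hA : ∀ i j, 0 ≤ A i j)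
    {t : ℝ} (ht : IsGreatest {t | A.IsSubeigenvalue t} t) :
    IsGreatest A.toComplex.spectralModuli t := by
  constructor
  · obtain ⟨x, hx, h⟩ := exists_eigenvector_of_nonneg hm hA ht
    obtain ⟨l, hl⟩ := exists_pos_of_mem_stdSimplex hx
    refine ⟨t, ⟨fun i => x i, Function.ne_iff.2 ⟨l, Complex.ofReal_ne_zero.2 hl.ne'⟩,
      fun i => ?_⟩, ?_⟩
    · have := congrArg Complex.ofReal (h i)
      simpa [apply, toComplex] using this
    · exact (Complex.norm_real t).trans (Real.norm_of_nonneg (ht.2 (isSubeigenvalue_zero hA)))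
  · rintro _ ⟨μ, hμ, rfl⟩
    exact ht.2 (isSubeigenvalue_norm hA hμ)

end PerronFrobenius

end Tensor

theorem theorem3p4 {m n : ℕ} [NeZero n] (hm : 2 ≤ m) (A : Tensor ℝ m n)
    (hA : ∀ i j, 0 ≤ A i j) (hr : ∀ i, A.rowSum i ≠ 0) (k : ℕ) :
    -- the maximum that defines the spectral radius exists, and no denominator vanishes
    IsGreatest A.toComplex.spectralModuli A.toComplex.spectralRadius ∧
    (∀ i, (A.pow k).rowSum i ≠ 0) ∧
    Finset.univ.inf' Finset.univ_nonempty
        (fun i : Fin n => (A.pow (k + 1)).rowSum i / (A.pow k).rowSum i ^ (m - 1))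
      ≤ A.toComplex.spectralRadius ∧
    A.toComplex.spectralRadius ≤
      Finset.univ.sup' Finset.univ_nonempty
        (fun i : Fin n => (A.pow (k + 1)).rowSum i / (A.pow k).rowSum i ^ (m - 1)) := by
  obtain ⟨t, ht⟩ := Tensor.exists_isGreatest_subeigenvalue hA
  have hgr := Tensor.isGreatest_spectralModuli (by omega) hA ht
  have hρ : A.toComplex.spectralRadius = t := hgr.csSup_eq
  have hpos := Tensor.rowSum_pow_pos hA hr k
  simp only [Tensor.rowSum_pow_succ hA k]
  rw [hρ]
  refine ⟨hgr, fun i => (hpos i).ne', ?_, ?_⟩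
  · refine ht.2 (Tensor.isSubeigenvalue_of_le (fun i => (hpos i).le)
      (Function.ne_iff.2 ⟨0, (hpos 0).ne'⟩) fun i => ?_)
    exact (le_div_iff₀ (pow_pos (hpos i) _)).1 (Finset.inf'_le _ (Finset.mem_univ i))
  · refine ht.1.le_of_apply_le hA hpos fun i => ?_
    exact (div_le_iff₀ (pow_pos (hpos i) _)).1
      (Finset.le_sup' (fun i => A.apply (A.pow k).rowSum i / (A.pow k).rowSum i ^ (m - 1))
        (Finset.mem_univ i))
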